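/- Let $n,l\ge 1$ and let $\Omega\subset\mathbb{R}^n$ be open; $\mathcal{L}^n$ is Lebesgue measure, $|\cdot|$ the Euclidean norm, and $B(x,r)$ the closed Euclidean ball of radius $r>0$. For $f:\Omega\to\mathbb{R}^l$ and $A\subset\Omega$ put $\operatorname{osc}(f,A)=\operatorname{diam} f(A)\in[0,\infty]$. $AC_H^{(n)}(\Omega,\mathbb{R}^l)$ (Hencl's class) is the set of functions $f:\Omega\to\mathbb{R}^l$ for which there exists $\lambda\in(0,1)$ such that for every $\varepsilon>0$ there is $\delta>0$ such that for every finite collection of pairwise disjoint closed balls $B(x_i,r_i)\subset\Omega$, $i=1,\dots,k$, $$\sum_{i=1}^k\mathcal{L}^n(B(x_i,r_i))<\delta\ \Longrightarrow\ \sum_{i=1}^k \operatorname{osc}(f,B(x_i,\lambda r_i))^n<\varepsilon .$$ For $a,b\in\mathbb{R}^n$ with $a_\nu\le b_\nu$ for all $\nu$, let $[a,b]=\{x\in\mathbb{R}^n: a_\nu\le x_\nu\le b_\nu,\ \nu=1,\dots,n\}$. A non-degenerate interval $[a,b]$ is $1$-regular if $\mathcal{L}^n([a,b])\ge(\max_\nu|a_\nu-b_\nu|)^n$.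 For $\lambda\in(0,1)$, $1\text{-}AC_\lambda^{(n)}(\Omega,\mathbb{R}^l)$ is the set of $f:\Omega\to\mathbb{R}^l$ such that for every $\varepsilon>0$ there is $\delta>0$ such that for every finite collection of pairwise disjoint $1$-regular intervals $[a_i,b_i]\subset\Omega$, $i=1,\dots,k$, $$\sum_{i=1}^k\mathcal{L}^n([a_i,b_i])<\delta\ \Longrightarrow\ \sum_{i=1}^k|f(d_i)-f(c_i)|^n<\varepsilon,$$ where $c_i=\tfrac{a_i+b_i}{2}-\tfrac{\lambda}{2}(b_i-a_i)$ and $d_i=\tfrac{a_i+b_i}{2}+\tfrac{\lambda}{2}(b_i-a_i)$. Let $1\text{-}AC_H^{(n)}(\Omega,\mathbb{R}^l)=\bigcap_{0<\lambda<1}1\text{-}AC_\lambda^{(n)}(\Omega,\mathbb{R}^l)$ (the classes $1\text{-}AC_\lambda^{(n)}(\Omega,\mathbb{R}^l)$ in fact do not depend on $\lambda$). Then $$AC_H^{(n)}(\Omega,\mathbb{R}^l)\subseteq 1\text{-}AC_H^{(n)}(\Omega,\mathbb{R}^l).$$ -/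

import Mathlib

open MeasureTheory

/-- The space `ℝⁿ` with its Euclidean norm and Lebesgue measure. -/
abbrev RSpace (n : ℕ) : Type := EuclideanSpace ℝ (Fin n)

noncomputable section

/-- The oscillation `osc(f, A) = diam f(A)`, with value `∞` when `f` is unbounded on `A`. -/
def oscOn {n l : ℕ} (f : RSpace n → RSpace l) (A : Set (RSpace n)) : ENNReal :=
  Metric.ediam (f '' A)

/-- Hencl's condition with parameter `lam`: for every `ε > 0` there is `δ > 0` such that for
every finite collection of disjoint closed Euclidean balls `B(xᵢ, rᵢ) ⊆ Ω` of total measure less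
than `δ`, the sum of `osc(f, B(xᵢ, lam rᵢ))ⁿ` is less than `ε`.
All the balls lie in `Ω`, so only the restriction of `f` to `Ω` matters. -/
def IsHenclAC {n l : ℕ} (Ω : Set (RSpace n)) (lam : ℝ) (f : RSpace n → RSpace l) : Prop :=
  ∀ ε : ℝ, 0 < ε → ∃ δ : ℝ, 0 < δ ∧
    ∀ (k : ℕ) (x : Fin k → RSpace n) (r : Fin k → ℝ),
      (∀ i, 0 < r i) →
      (∀ i, Metric.closedBall (x i) (r i) ⊆ Ω) →
      (∀ i j, i ≠ j →
        Disjoint (Metric.closedBall (x i) (r i)) (Metric.closedBall (x j) (r j))) →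
      ∑ i, volume (Metric.closedBall (x i) (r i)) < ENNReal.ofReal δ →
      ∑ i, oscOn f (Metric.closedBall (x i) (lam * r i)) ^ n < ENNReal.ofReal ε

/-- Hencl's class `AC_H⁽ⁿ⁾(Ω, ℝˡ)`: the condition holds for some `lam ∈ (0, 1)`. A function
`Ω → ℝˡ` is represented by any of its extensions to `ℝⁿ`. -/
def ACH {n : ℕ} (l : ℕ) (Ω : Set (RSpace n)) : Set (RSpace n → RSpace l) :=
  {f | ∃ lam : ℝ, 0 < lam ∧ lam < 1 ∧ IsHenclAC Ω lam f}

/-- The interval `[a, b] = {x | a_ν ≤ x_ν ≤ b_ν for all ν}`. -/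
def interval {n : ℕ} (a b : RSpace n) : Set (RSpace n) :=
  {x | ∀ ν, a ν ≤ x ν ∧ x ν ≤ b ν}

/-- `[a, b]` is `α`-regular: `ℒⁿ([a, b]) / (max_ν |a_ν - b_ν|)ⁿ ≥ α`.
For `n ≥ 1` and `α > 0` this excludes the one-point intervals (the quotient `0 / 0` is `0`). -/
def IsRegularInterval {n : ℕ} (α : ℝ) (a b : RSpace n) : Prop :=
  (∀ ν, a ν ≤ b ν) ∧ α ≤ volume.real (interval a b) / (⨆ ν, |a ν - b ν|) ^ n

/-- The lower endpoint of the interval concentric with `[a, b]` with sides `lam (b_ν - a_ν)`. -/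
def shrinkLeft {n : ℕ} (lam : ℝ) (a b : RSpace n) : RSpace n :=
  (1 / 2 : ℝ) • (a + b) - (lam / 2) • (b - a)

/-- The upper endpoint of the interval concentric with `[a, b]` with sides `lam (b_ν - a_ν)`. -/
def shrinkRight {n : ℕ} (lam : ℝ) (a b : RSpace n) : RSpace n :=
  (1 / 2 : ℝ) • (a + b) + (lam / 2) • (b - a)

/-- The class `α-AC_lam⁽ⁿ⁾(Ω, ℝˡ)` (used for `0 < α ≤ 1` and `0 < lam < 1`): for every `ε > 0`
there is `δ > 0` such that for every finite collection of disjoint `α`-regular intervals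
`[aᵢ, bᵢ] ⊆ Ω` of total measure less than `δ`, the sum of `|f(dᵢ) - f(cᵢ)|ⁿ` is less than `ε`,
where `[cᵢ, dᵢ]` is the interval concentric with `[aᵢ, bᵢ]` and scaled by `lam`.
The points `cᵢ`, `dᵢ` lie in `Ω`, so only the restriction of `f` to `Ω` matters. -/
def alphaAC {n : ℕ} (l : ℕ) (α lam : ℝ) (Ω : Set (RSpace n)) : Set (RSpace n → RSpace l) :=
  {f | ∀ ε : ℝ, 0 < ε → ∃ δ : ℝ, 0 < δ ∧
    ∀ (k : ℕ) (a b : Fin k → RSpace n),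
      (∀ i, IsRegularInterval α (a i) (b i)) →
      (∀ i, interval (a i) (b i) ⊆ Ω) →
      (∀ i j, i ≠ j → Disjoint (interval (a i) (b i)) (interval (a j) (b j))) →
      ∑ i, volume (interval (a i) (b i)) < ENNReal.ofReal δ →
      ∑ i, ‖f (shrinkRight lam (a i) (b i)) - f (shrinkLeft lam (a i) (b i))‖ ^ n < ε}

/-- The class `1-AC_H⁽ⁿ⁾(Ω, ℝˡ)`: membership in `1-AC_lam⁽ⁿ⁾(Ω, ℝˡ)` for every `lam ∈ (0, 1)`.
(These classes are all equal; asking for every `lam` is the strongest reading.) -/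
def oneACH {n : ℕ} (l : ℕ) (Ω : Set (RSpace n)) : Set (RSpace n → RSpace l) :=
  {f | ∀ lam : ℝ, 0 < lam → lam < 1 → f ∈ alphaAC l 1 lam Ω}

end

/-! A `1`-regular interval is a cube, so the diagonal segment from `c` to `d` keeps distance `(1 -
lam) / 2 * s` from its faces, `s` being the side. Cut the segment into `N` equal steps, with `N`
depending only on `n`, `lam`, `mu`. Balls of that radius at the division points stay in the cube,
and their `mu`-shrinkings contain the next point. For each fixed step, one ball per cube gives a
disjoint family to which Hencl's condition applies; the power mean inequality recombines the `N`
steps. -/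

theorem volume_interval {n : ℕ} (a b : RSpace n) :
    volume (interval a b) = ∏ ν, ENNReal.ofReal (b ν - a ν) := by
  have h : interval a b = (WithLp.ofLp : RSpace n → Fin n → ℝ) ⁻¹' Set.Icc a.ofLp b.ofLp := by
    ext x
    simp [interval, Pi.le_def, forall_and]
  rw [h, (PiLp.volume_preserving_ofLp (Fin n)).measure_preimage
    measurableSet_Icc.nullMeasurableSet, Real.volume_Icc_pi]

theorem abs_sub_le_iSup {n : ℕ} (a b : RSpace n) (ν : Fin n) :
    |a ν - b ν| ≤ ⨆ μ, |a μ - b μ| :=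
  le_ciSup (f := fun μ => |a μ - b μ|) (Set.finite_range _).bddAbove ν

/-- In positive dimension a `1`-regular interval is a non-degenerate cube. -/
theorem IsRegularInterval.exists_side {n : ℕ} (hn : n ≠ 0) {a b : RSpace n}
    (h : IsRegularInterval 1 a b) : ∃ s : ℝ, 0 < s ∧ ∀ ν, b ν - a ν = s := by
  obtain ⟨hab, h⟩ := h
  set M := ⨆ ν, |a ν - b ν| with hM
  have hle : ∀ ν, b ν - a ν ≤ M := fun ν =>
    (by rw [abs_sub_comm]; exact le_abs_self _ : b ν - a ν ≤ |a ν - b ν|).trans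
      (abs_sub_le_iSup a b ν)
  have hM0 : 0 ≤ M := Real.iSup_nonneg fun ν => abs_nonneg _
  have hMpos : 0 < M := by
    refine hM0.lt_of_ne fun h0 => ?_
    rw [← h0, zero_pow hn, div_zero] at h
    linarith
  have hvol : volume.real (interval a b) = ∏ ν, (b ν - a ν) := by
    rw [Measure.real, volume_interval, ENNReal.toReal_prod]
    exact Finset.prod_congr rfl fun ν _ => ENNReal.toReal_ofReal (sub_nonneg.2 (hab ν))
  rw [hvol, one_le_div (by positivity)] at h
  refine ⟨M, hMpos, fun ν => (hle ν).antisymm ?_⟩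
  -- The product of all sides is at least `M ^ n`; since the other sides contribute at most `M ^ (n
  -- - 1)`, side `ν` is at least `M`.
  have hrest : ∏ μ ∈ Finset.univ.erase ν, (b μ - a μ) ≤ M ^ (n - 1) := by
    calc _ ≤ ∏ μ ∈ Finset.univ.erase ν, M :=
          Finset.prod_le_prod (fun μ _ => sub_nonneg.2 (hab μ)) fun μ _ => hle μ
      _ = M ^ (n - 1) := by simp
  rw [← Finset.mul_prod_erase _ _ (Finset.mem_univ ν)] at h
  have h2 : M * M ^ (n - 1) ≤ (b ν - a ν) * M ^ (n - 1) := by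
    rw [mul_pow_sub_one hn]
    exact h.trans (mul_le_mul_of_nonneg_left hrest (sub_nonneg.2 (hab ν)))
  exact le_of_mul_le_mul_right h2 (by positivity)

/-- The point dividing the segment from `shrinkLeft lam a b` to `shrinkRight lam a b` in the
ratio `t : 1 - t`. -/
noncomputable def shrinkPoint {n : ℕ} (lam : ℝ) (a b : RSpace n) (t : ℝ) : RSpace n :=
  shrinkLeft lam a b + (t * lam) • (b - a)

theorem shrinkPoint_zero {n : ℕ} (lam : ℝ) (a b : RSpace n) :
    shrinkPoint lam a b 0 = shrinkLeft lam a b := by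
  simp [shrinkPoint]

theorem shrinkPoint_one {n : ℕ} (lam : ℝ) (a b : RSpace n) :
    shrinkPoint lam a b 1 = shrinkRight lam a b := by
  simp only [shrinkPoint, shrinkLeft, shrinkRight]
  module

theorem shrinkPoint_apply {n : ℕ} (lam : ℝ) (a b : RSpace n) (t : ℝ) (ν : Fin n) :
    shrinkPoint lam a b t ν =
      a ν + ((1 - lam) / 2 + t * lam) * (b ν - a ν) := by
  simp [shrinkPoint, shrinkLeft]
  ring

theorem closedBall_shrinkPoint_subset {n : ℕ} {lam : ℝ} (hl : 0 ≤ lam)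
    {a b : RSpace n} {s : ℝ} (hs : 0 ≤ s) (hab : ∀ ν, b ν - a ν = s) {t : ℝ}
    (ht0 : 0 ≤ t) (ht1 : t ≤ 1) :
    Metric.closedBall (shrinkPoint lam a b t) ((1 - lam) / 2 * s) ⊆ interval a b := by
  intro x hx ν
  have h1 : |x ν - shrinkPoint lam a b t ν| ≤ (1 - lam) / 2 * s := by
    rw [Metric.mem_closedBall, dist_eq_norm] at hx
    simpa using (PiLp.norm_apply_le (x - shrinkPoint lam a b t) ν).trans hx
  rw [shrinkPoint_apply, hab, abs_le] at h1
  have h2 : 0 ≤ t * lam * s := by positivity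
  have h3 : 0 ≤ (1 - t) * lam * s := mul_nonneg (mul_nonneg (sub_nonneg.2 ht1) hl) hs
  have h4 := hab ν
  constructor <;> nlinarith

theorem dist_shrinkPoint {n : ℕ} {lam : ℝ} (hl : 0 ≤ lam) {a b : RSpace n} {s : ℝ}
    (hs : 0 ≤ s) (hab : ∀ ν, b ν - a ν = s) (t u : ℝ) :
    dist (shrinkPoint lam a b t) (shrinkPoint lam a b u) = |t - u| * lam * (√n * s) := by
  have h1 : ‖b - a‖ = √n * s := by
    rw [EuclideanSpace.norm_eq]
    simp [hab, Real.sqrt_sq hs]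
  have h2 : shrinkPoint lam a b t - shrinkPoint lam a b u = ((t - u) * lam) • (b - a) := by
    simp only [shrinkPoint]
    module
  rw [dist_eq_norm, h2, norm_smul, h1, norm_mul, Real.norm_eq_abs, Real.norm_of_nonneg hl]

theorem edist_le_oscOn {n l : ℕ} (f : RSpace n → RSpace l) {A : Set (RSpace n)} {x y : RSpace n}
    (hx : x ∈ A) (hy : y ∈ A) : edist (f x) (f y) ≤ oscOn f A :=
  Metric.edist_le_ediam_of_mem (Set.mem_image_of_mem f hx) (Set.mem_image_of_mem f hy)

/-- Every interval is then a point of volume `1`, so `δ = 1` forces the family to be empty. -/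
theorem alphaAC_zero_dim {l : ℕ} (α lam : ℝ) (Ω : Set (RSpace 0)) (f : RSpace 0 → RSpace l) :
    f ∈ alphaAC l α lam Ω := by
  intro ε hε
  refine ⟨1, one_pos, fun k a b _ _ _ hvol => ?_⟩
  simp only [volume_interval, Finset.univ_eq_empty, Finset.prod_empty, Finset.sum_const,
    Finset.card_univ, Fintype.card_fin, nsmul_eq_mul, mul_one, ENNReal.ofReal_one,
    Nat.cast_lt_one] at hvol
  subst hvol
  simpa using hε

/-- If `N` is large, the segment joining the two diagonal points is covered by a chain of `N`
small balls whose enlargements stay inside the cube. -/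
theorem IsHenclAC.mem_alphaAC {n l : ℕ} (hn : n ≠ 0) {Ω : Set (RSpace n)} {mu lam : ℝ}
    (hmu : 0 < mu) (hl : 0 < lam) (hl1 : lam < 1) {f : RSpace n → RSpace l}
    (hf : IsHenclAC Ω mu f) : f ∈ alphaAC l 1 lam Ω := by
  -- Makes the step length `lam * √n * s / N` smaller than the shrunken radius `mu * ((1 - lam) / 2)
  -- * s`, for every side `s`.
  obtain ⟨N, hN⟩ := exists_nat_gt (lam * √n / (mu * ((1 - lam) / 2)))
  have hl2 : 0 < (1 - lam) / 2 := by linarith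
  have hN0 : (0 : ℝ) < N := lt_of_le_of_lt (by positivity) hN
  have hNN : N ≠ 0 := by exact_mod_cast hN0.ne'
  rw [div_lt_iff₀ (by positivity)] at hN
  intro ε hε
  -- The loss `N ^ n` is `N` steps times the power mean factor `N ^ (n - 1)`.
  obtain ⟨δ, hδ, H⟩ := hf (ε / N ^ n) (by positivity)
  refine ⟨δ, hδ, fun k a b hreg hsub hdisj hvol => ?_⟩
  choose s hs hab using fun i => (hreg i).exists_side hn
  let p : Fin k → ℕ → RSpace n := fun i j => shrinkPoint lam (a i) (b i) (j / N)
  have hball : ∀ j < N, ∀ i,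
      Metric.closedBall (p i j) ((1 - lam) / 2 * s i) ⊆ interval (a i) (b i) := by
    intro j hj i
    refine closedBall_shrinkPoint_subset hl.le (hs i).le (hab i) (by positivity) ?_
    exact div_le_one_of_le₀ (by exact_mod_cast hj.le) hN0.le
  have hstep : ∀ j < N, ∑ i, ‖f (p i (j + 1)) - f (p i j)‖ ^ n < ε / N ^ n := by
    intro j hj
    have h1 := H k (fun i => p i j) (fun i => (1 - lam) / 2 * s i)
      (fun i => mul_pos hl2 (hs i)) (fun i => (hball j hj i).trans (hsub i))
      (fun i i' hii => (hdisj i i' hii).mono (hball j hj i) (hball j hj i'))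
      ((Finset.sum_le_sum fun i _ => measure_mono (hball j hj i)).trans_lt hvol)
    rw [← ENNReal.ofReal_lt_ofReal_iff (by positivity),
      ENNReal.ofReal_sum_of_nonneg fun i _ => by positivity]
    refine (Finset.sum_le_sum fun i _ => ?_).trans_lt h1
    rw [ENNReal.ofReal_pow (norm_nonneg _), ← dist_eq_norm, ← edist_dist]
    refine pow_le_pow_left' (edist_le_oscOn f ?_ (Metric.mem_closedBall_self ?_)) n
    · rw [Metric.mem_closedBall, dist_shrinkPoint hl.le (hs i).le (hab i)]
      have h2 : |((j + 1 : ℕ) : ℝ) / N - j / N| = 1 / N := by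
        rw [← sub_div, abs_of_nonneg (by push_cast; simp)]
        push_cast
        ring
      rw [h2, one_div, inv_mul_eq_div, div_mul_eq_mul_div, div_le_iff₀ hN0]
      nlinarith [mul_le_mul_of_nonneg_right hN.le (hs i).le]
    · exact mul_nonneg hmu.le (mul_nonneg hl2.le (hs i).le)
  have hchain : ∀ i, ‖f (shrinkRight lam (a i) (b i)) - f (shrinkLeft lam (a i) (b i))‖ ^ n ≤
      N ^ (n - 1) * ∑ j ∈ Finset.range N, ‖f (p i (j + 1)) - f (p i j)‖ ^ n := by
    intro i
    have h0 : p i 0 = shrinkLeft lam (a i) (b i) := by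
      simp [p, shrinkPoint_zero]
    have h1 : p i N = shrinkRight lam (a i) (b i) := by
      simp [p, div_self hN0.ne', shrinkPoint_one]
    rw [← h0, ← h1, ← Finset.sum_range_sub (fun j => f (p i j)) N]
    refine (pow_le_pow_left₀ (norm_nonneg _) (norm_sum_le _ _) n).trans ?_
    obtain ⟨m, rfl⟩ := Nat.exists_eq_succ_of_ne_zero hn
    have h2 := pow_sum_div_card_le_sum_pow (s := Finset.range N)
      (f := fun j => ‖f (p i (j + 1)) - f (p i j)‖) (fun j _ => norm_nonneg _) m
    rwa [Finset.card_range, div_le_iff₀' (by positivity)] at h2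
  calc ∑ i, ‖f (shrinkRight lam (a i) (b i)) - f (shrinkLeft lam (a i) (b i))‖ ^ n
      ≤ ∑ i, N ^ (n - 1) * ∑ j ∈ Finset.range N, ‖f (p i (j + 1)) - f (p i j)‖ ^ n :=
        Finset.sum_le_sum fun i _ => hchain i
    _ = N ^ (n - 1) * ∑ j ∈ Finset.range N, ∑ i, ‖f (p i (j + 1)) - f (p i j)‖ ^ n := by
        rw [← Finset.mul_sum, Finset.sum_comm]
    _ < N ^ (n - 1) * ∑ j ∈ Finset.range N, ε / N ^ n := by
        refine mul_lt_mul_of_pos_left ?_ (by positivity)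
        exact Finset.sum_lt_sum_of_nonempty (Finset.nonempty_range_iff.2 hNN)
          fun j hj => hstep j (Finset.mem_range.1 hj)
    _ = ε := by
        rw [Finset.sum_const, Finset.card_range, nsmul_eq_mul, ← mul_assoc, pow_sub_one_mul hn,
          mul_div_cancel₀ _ (by positivity)]

theorem mainTheorem12 (n l : ℕ) (Ω : Set (RSpace n)) (hΩ : IsOpen Ω) :
    ACH l Ω ⊆ oneACH l Ω := by
  rintro f ⟨mu, hmu, hmu1, hf⟩ lam hl hl1
  rcases eq_or_ne n 0 with rfl | hn
  · exact alphaAC_zero_dim 1 lam Ω f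
  · exact hf.mem_alphaAC hn hmu hl hl1
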